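/- Let $n\ge 32000$ and $L=\tfrac18(\ln n/n)^{1/3}$. There are $n$ men and $n$ women. Each man $m$ has a public rating $r_m$ and each woman $w$ a public rating $r_w$; each man $m$ has a private score $s_m(w)$ for each woman $w$, and each woman $w$ a private score $s_w(m)$ for each man $m$; all ratings and scores are independent and uniform on $[0,1]$. In the linear separable model with $\lambda=\tfrac12$, the utility of $m$ for $w$ is $\tfrac12 r_w+\tfrac12 s_m(w)$ and the utility of $w$ for $m$ is $\tfrac12 r_m+\tfrac12 s_w(m)$. Order the men as $m_1,\dots,m_n$ and the women as $w_1,\dots,w_n$ by descending public rating. The loss of $m_i$ from a match of utility $u$ is $\tfrac12 r_{w_i}+\tfrac12-u$, and the loss of $w_i$ from a match of utility $u$ is $\tfrac12 r_{m_i}+\tfrac12-u$. Then, with probability at least $\tfrac14 n^{-1/8}$, there is no perfect matching between the men and the women (and in particular no stable matching, i.e. no perfect matching $\mu$ without an unmatched pair $(m,w)$ each of whom has strictly greater utility for the other than for the partner assigned by $\mu$) in which every agent (man or woman) with public rating at least $\tfrac32L$ suffers a loss of at most $L$. -/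

import Mathlib

open MeasureTheory

noncomputable section

/-- The men and the women, `n` of each. -/
abbrev Man (n : ℕ) := Fin n
abbrev Woman (n : ℕ) := Fin n

/-- The random data of a market with `n` men and `n` women: the public ratings of the men, the
public ratings of the women, the private scores `s_m(w)` of the men and the private scores
`s_w(m)` of the women. Its `volume` is the product of the uniform (Lebesgue) probability
measures on the factors `[0,1]`, so all these numbers are independent uniform draws. -/
abbrev Market (n : ℕ) :=
  (Man n → unitInterval) × (Woman n → unitInterval) ×
    (Man n → Woman n → unitInterval) × (Woman n → Man n → unitInterval)

namespace Market

variable {n : ℕ}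

/-- The public rating `r_m` of the man `m`. -/
def manRating (ω : Market n) (m : Man n) : ℝ := ω.1 m

/-- The public rating `r_w` of the woman `w`. -/
def womanRating (ω : Market n) (w : Woman n) : ℝ := ω.2.1 w

/-- The private score `s_m(w)` that the man `m` gives to the woman `w`. -/
def manScore (ω : Market n) (m : Man n) (w : Woman n) : ℝ := ω.2.2.1 m w

/-- The private score `s_w(m)` that the woman `w` gives to the man `m`. -/
def womanScore (ω : Market n) (w : Woman n) (m : Man n) : ℝ := ω.2.2.2 w m

/-- The agents of one side in descending order of public rating: `byRank r i` is the agent with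
the `i`-th highest rating, counting from `0`. Ties, which have probability zero, are broken by
the index. -/
def byRank (r : Fin n → ℝ) : Equiv.Perm (Fin n) := Tuple.sort (OrderDual.toDual ∘ r)

/-- The woman aligned with the man `m`: the one with the same public rank. -/
def alignedWoman (ω : Market n) (m : Man n) : Woman n :=
  byRank ω.womanRating ((byRank ω.manRating).symm m)

/-- The man aligned with the woman `w`: the one with the same public rank. -/
def alignedMan (ω : Market n) (w : Woman n) : Man n :=
  byRank ω.manRating ((byRank ω.womanRating).symm w)

/-- The utility function of the linear separable model with parameter `lam`. -/
def linearUtility (lam r s : ℝ) : ℝ := lam * r + (1 - lam) * s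

/-- The utility that the man `m` has for the woman `w`. -/
def manUtility (lam : ℝ) (ω : Market n) (m : Man n) (w : Woman n) : ℝ :=
  linearUtility lam (ω.womanRating w) (ω.manScore m w)

/-- The utility that the woman `w` has for the man `m`. -/
def womanUtility (lam : ℝ) (ω : Market n) (w : Woman n) (m : Man n) : ℝ :=
  linearUtility lam (ω.manRating m) (ω.womanScore w m)

/-- The loss of the man `m` when he is matched with the woman `w`. -/
def manLoss (lam : ℝ) (ω : Market n) (m : Man n) (w : Woman n) : ℝ :=
  linearUtility lam (ω.womanRating (ω.alignedWoman m)) 1 - manUtility lam ω m w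

/-- The loss of the woman `w` when she is matched with the man `m`. -/
def womanLoss (lam : ℝ) (ω : Market n) (w : Woman n) (m : Man n) : ℝ :=
  linearUtility lam (ω.manRating (ω.alignedMan w)) 1 - womanUtility lam ω w m

/-- In the perfect matching `μ` every agent, man or woman, whose public rating is at least `σ`
suffers a loss of at most `L`. -/
def LossAtMost (lam : ℝ) (ω : Market n) (L σ : ℝ) (μ : Man n ≃ Woman n) : Prop :=
  (∀ m : Man n, σ ≤ ω.manRating m → manLoss lam ω m (μ m) ≤ L) ∧
    (∀ w : Woman n, σ ≤ ω.womanRating w → womanLoss lam ω w (μ.symm w) ≤ L)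

/-- The pair `(m, w)` blocks the matching `μ`. -/
def IsBlockingPair (lam : ℝ) (ω : Market n) (μ : Man n ≃ Woman n) (m : Man n) (w : Woman n) :
    Prop :=
  μ m ≠ w ∧ manUtility lam ω m (μ m) < manUtility lam ω m w ∧
    womanUtility lam ω w (μ.symm w) < womanUtility lam ω w m

/-- The matching `μ` is stable. -/
def IsStable (lam : ℝ) (ω : Market n) (μ : Man n ≃ Woman n) : Prop :=
  ∀ (m : Man n) (w : Woman n), ¬ IsBlockingPair lam ω μ m w

end Market

end

open ProbabilityTheory

namespace Market

/-! The top-rated man `m` alone obstructs small losses. Suppose some woman is rated at least `1 -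
L`, and at least as many men have rating `≥ 1 - 5L` as women have rating `≥ 1 - 3L`. If losses are
at most `L`, the partner `w` of `m` is rated at least `1 - 3L`, so her aligned man is rated at least
`1 - 5L`; this forces `s_m(w) ≥ 1 - 2L` and `s_w(m) ≥ 1 - 7L` (`exists_high_scores`). By Chebyshev
the ratings of each side behave well with probability at least 1/2, with at most `4Ln` candidates
`w`. Given the ratings, every candidate fails with probability at least `(1 - 14L²)^(4Ln) ≥
exp(-64L³n) = n^(-1/8)` (`volume_scores_eq`, `rpow_le_pow_card`). -/

/-- A lower bound for the product measure of an arbitrary set in terms of its sections. -/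
lemma mul_le_prod_of_le_section {α β : Type*} [MeasurableSpace α] [MeasurableSpace β]
    {μ : Measure α} {ν : Measure β} [SFinite ν] {E : Set (α × β)} {A : Set α} {a b : ENNReal}
    (hA : a ≤ μ A) (hE : ∀ x ∈ A, b ≤ ν {y | (x, y) ∈ E}) : a * b ≤ μ.prod ν E := by
  have hT := measurableSet_toMeasurable (μ.prod ν) E
  rw [← measure_toMeasurable E, Measure.prod_apply hT, mul_comm]
  -- Markov's inequality for the section measure. Passing to a measurable hull of `E` avoids
  -- measurability assumptions on `E` and `A`.
  refine le_trans ?_ (mul_meas_ge_le_lintegral (measurable_measure_prodMk_left hT) b)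
  gcongr
  refine hA.trans (measure_mono fun x hx => ?_)
  exact (hE x hx).trans (measure_mono fun y hy => subset_toMeasurable _ _ hy)

/-! ### Public ratings: ranks and concentration -/

lemma volume_one_sub_le {t : ℝ} (h0 : 0 ≤ t) (h1 : t ≤ 1) :
    volume {x : unitInterval | 1 - t ≤ (x : ℝ)} = ENNReal.ofReal t := by
  have h : {x : unitInterval | 1 - t ≤ (x : ℝ)} =
      Set.Ici (⟨1 - t, by linarith, by linarith⟩ : unitInterval) := by
    ext x; simp [← Subtype.coe_le_coe]
  rw [h, unitInterval.volume_Ici]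
  simp

lemma measurableSet_one_sub_le (t : ℝ) :
    MeasurableSet {x : unitInterval | 1 - t ≤ (x : ℝ)} :=
  measurableSet_le measurable_const measurable_subtype_coe

/-- The number of agents whose rating is at least `1 - t`. -/
noncomputable def numTop {n : ℕ} (r : Fin n → ℝ) (t : ℝ) : ℕ :=
  (Finset.univ.filter fun i => 1 - t ≤ r i).card

/-- Turns rating thresholds into ranks, so that they can be carried from one side of the market to
the other. Ranks start at 0, hence the strict inequality. -/
lemma le_byRank_iff {n : ℕ} (r : Fin n → ℝ) (t : ℝ) (j : Fin n) :
    1 - t ≤ r (byRank r j) ↔ (j : ℕ) < numTop r t := by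
  have hanti : Antitone (r ∘ byRank r) := fun a b hab =>
    Tuple.monotone_sort (OrderDual.toDual ∘ r) hab
  have h := Tuple.lt_card_ge_iff_apply_ge_of_antitone (a := 1 - t) (j := j) hanti
  rw [Function.comp_apply] at h
  rw [← h, numTop]
  have hc : (Finset.univ.filter fun i => (1 - t ≤ (r ∘ byRank r) i)).card =
      (Finset.univ.filter fun i => 1 - t ≤ r i).card :=
    Finset.card_equiv (byRank r) (by simp)
  rw [← hc]

lemma le_byRank_zero {n : ℕ} (hn : 0 < n) (r : Fin n → ℝ) (i : Fin n) :
    r i ≤ r (byRank r ⟨0, hn⟩) := by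
  have h := (le_byRank_iff r (1 - r i) ⟨0, hn⟩).2
    (Finset.card_pos.2 ⟨i, by simp⟩)
  linarith

/-- Chebyshev's inequality for the number of ratings that are at least `1 - t`. -/
lemma volume_le_abs_numTop_sub {n : ℕ} {t δ : ℝ} (h0 : 0 ≤ t) (h1 : t ≤ 1) (hδ : 0 < δ) :
    volume {r : Fin n → unitInterval | δ ≤ |(numTop (fun i => (r i : ℝ)) t : ℝ) - n * t|} ≤
      ENNReal.ofReal (n * t / δ ^ 2) := by
  set S : Set unitInterval := {x : unitInterval | 1 - t ≤ (x : ℝ)} with hS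
  have hSm : MeasurableSet S := measurableSet_one_sub_le t
  set X : unitInterval → ℝ := S.indicator fun _ => (1 : ℝ) with hX
  have hXL : MemLp X 2 (volume : Measure unitInterval) :=
    (memLp_const (1 : ℝ)).indicator hSm
  have hSr : (volume : Measure unitInterval).real S = t := by
    rw [Measure.real, volume_one_sub_le h0 h1, ENNReal.toReal_ofReal h0]
  have hXint : ∫ x, X x = t := by
    rw [hX, integral_indicator_const _ hSm, hSr]; simp
  have hXvar : Var[X; volume] ≤ t := by
    refine (variance_le_expectation_sq hXL.aestronglyMeasurable).trans (le_of_eq ?_)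
    rw [← hXint]
    refine integral_congr_ae (Filter.Eventually.of_forall fun x => ?_)
    by_cases hx : x ∈ S <;> simp [hX, hx]
  have hcomp : ∀ i : Fin n, MemLp (fun r : Fin n → unitInterval => X (r i)) 2 volume := fun i =>
    hXL.comp_measurePreserving (measurePreserving_eval (fun _ => volume) i)
  set Y : (Fin n → unitInterval) → ℝ := ∑ i, fun r => X (r i) with hY
  have hYL : MemLp Y 2 (volume : Measure (Fin n → unitInterval)) :=
    memLp_finsetSum' _ fun i _ => hcomp i
  have hYN : ∀ r, Y r = numTop (fun i => (r i : ℝ)) t := by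
    intro r
    simp only [hY, Finset.sum_apply, hX, numTop, Finset.card_filter, Nat.cast_sum]
    refine Finset.sum_congr rfl fun i _ => ?_
    simp [Set.indicator_apply, hS]
  have hYint : ∫ r, Y r = n * t := by
    simp only [hY, Finset.sum_apply]
    rw [integral_finsetSum _ fun i _ => (hcomp i).integrable (by norm_num)]
    have h : ∀ i : Fin n, ∫ r : Fin n → unitInterval, X (r i) = t := fun i => by
      rw [← hXint]
      exact integral_comp_eval (μ := fun _ : Fin n => (volume : Measure unitInterval))
        hXL.aestronglyMeasurable
    simp [h]
  have hYvar : Var[Y; volume] ≤ n * t := by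
    have h := variance_sum_pi (μ := fun _ : Fin n => (volume : Measure unitInterval))
      (X := fun _ => X) fun _ => hXL
    rw [← volume_pi] at h
    rw [hY, h]
    simpa using mul_le_mul_of_nonneg_left hXvar (Nat.cast_nonneg n)
  have hch := meas_ge_le_variance_div_sq hYL hδ
  rw [hYint] at hch
  simp only [hYN] at hch
  exact hch.trans (ENNReal.ofReal_le_ofReal (by gcongr))

/-- A set whose complement has measure at most one half has measure at least one half. -/
lemma half_le_of_compl_subset {α : Type*} [MeasurableSpace α] {μ : Measure α}
    [IsProbabilityMeasure μ] {A B : Set α} {b : ℝ} (hb : b ≤ 1 / 2)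
    (hB : μ B ≤ ENNReal.ofReal b) (h : Aᶜ ⊆ B) : ENNReal.ofReal (1 / 2) ≤ μ A := by
  have h1 : (1 : ENNReal) ≤ μ A + ENNReal.ofReal (1 / 2) := by
    calc (1 : ENNReal) = μ (A ∪ Aᶜ) := by simp
      _ ≤ μ A + μ Aᶜ := measure_union_le _ _
      _ ≤ _ := by
        gcongr
        exact (measure_mono h).trans (hB.trans (ENNReal.ofReal_le_ofReal hb))
  have h2 : (1 : ENNReal) = ENNReal.ofReal (1 / 2) + ENNReal.ofReal (1 / 2) := by
    rw [← ENNReal.ofReal_add (by norm_num) (by norm_num)]; norm_num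
  rw [h2] at h1
  exact (ENNReal.add_le_add_iff_right ENNReal.ofReal_ne_top).1 h1

lemma half_le_volume_men {n : ℕ} {L : ℝ} (hL0 : 0 < L) (hL1 : L ≤ 1 / 16) (hLn : 10 ≤ L * n) :
    ENNReal.ofReal (1 / 2) ≤
      volume {r : Fin n → unitInterval | 4 * (L * n) ≤ numTop (fun i => (r i : ℝ)) (5 * L)} := by
  refine half_le_of_compl_subset ?_
    (volume_le_abs_numTop_sub (t := 5 * L) (δ := L * n) (by linarith) (by linarith) (by linarith))
    fun r hr => ?_
  -- The Chebyshev bound is `5/(Ln) ≤ 1/2`.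
  · rw [div_le_iff₀ (by positivity)]
    nlinarith
  · simp only [Set.mem_compl_iff, Set.mem_ofPred_eq, not_le] at hr ⊢
    rw [le_abs]; right; linarith

lemma half_le_volume_women {n : ℕ} {L : ℝ} (hL0 : 0 < L) (hL1 : L ≤ 1 / 16)
    (hLn : 10 ≤ L * n) :
    ENNReal.ofReal (1 / 2) ≤
      volume {r : Fin n → unitInterval | numTop (fun i => (r i : ℝ)) (3 * L) ≤ 4 * (L * n) ∧
        0 < numTop (fun i => (r i : ℝ)) L} := by
  have h3 := volume_le_abs_numTop_sub (n := n) (t := 3 * L) (δ := L * n) (by linarith)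
    (by linarith) (by linarith)
  have h1 := volume_le_abs_numTop_sub (n := n) (t := L) (δ := L * n) (by linarith)
    (by linarith) (by linarith)
  refine half_le_of_compl_subset (b := n * (3 * L) / (L * n) ^ 2 + n * L / (L * n) ^ 2) ?_
    ((measure_union_le _ _).trans ((add_le_add h3 h1).trans (ENNReal.ofReal_add ?_ ?_).ge))
    fun r hr => ?_
  -- The two Chebyshev bounds add up to `4/(Ln) ≤ 2/5`.
  · rw [← add_div, div_le_iff₀ (by positivity)]
    nlinarith
  · positivity
  · positivity
  · simp only [Set.mem_compl_iff, Set.mem_ofPred_eq, not_and_or, not_le, not_lt,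
      Nat.le_zero, Set.mem_union] at hr ⊢
    rcases hr with hr | hr
    · left; rw [le_abs]; left; linarith
    · right; rw [hr, le_abs]; right; push_cast; linarith

/-! ### Private scores of the best man and his candidates -/

/-- The probability that no woman in `W` has a mutually high score with the man `m`. -/
lemma volume_scores_eq {n : ℕ} (m : Fin n) (W : Finset (Fin n)) {p q : ℝ}
    (hp0 : 0 ≤ p) (hp1 : p ≤ 1) (hq0 : 0 ≤ q) (hq1 : q ≤ 1) :
    volume {s : (Man n → Woman n → unitInterval) × (Woman n → Man n → unitInterval) |
      ∀ w ∈ W, ¬ (1 - p ≤ (s.1 m w : ℝ) ∧ 1 - q ≤ (s.2 w m : ℝ))} =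
        ENNReal.ofReal (1 - p * q) ^ W.card := by
  classical
  let I := unitInterval
  let Q : Set (I × I) := {x | 1 - p ≤ (x.1 : ℝ)} ∩ {x | 1 - q ≤ (x.2 : ℝ)}
  have hQ : Q = {x : I | 1 - p ≤ (x : ℝ)} ×ˢ {x : I | 1 - q ≤ (x : ℝ)} := rfl
  have hQm : MeasurableSet Q := by
    rw [hQ]; exact (measurableSet_one_sub_le p).prod (measurableSet_one_sub_le q)
  have hQv : volume Qᶜ = ENNReal.ofReal (1 - p * q) := by
    rw [prob_compl_eq_one_sub hQm, hQ, Measure.volume_eq_prod, Measure.prod_prod,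
      volume_one_sub_le hp0 hp1, volume_one_sub_le hq0 hq1, ← ENNReal.ofReal_mul hp0,
      ENNReal.ofReal_sub _ (by positivity), ENNReal.ofReal_one]
  have h1 : MeasurePreserving (fun s : Fin n → Fin n → I => s m) volume volume :=
    measurePreserving_eval (fun _ => (volume : Measure (Fin n → I))) m
  have h2 : MeasurePreserving (fun (s : Fin n → Fin n → I) w => s w m) volume volume :=
    volume_preserving_pi (f := fun _ (x : Fin n → I) => x m) fun _ =>
      measurePreserving_eval (fun _ => (volume : Measure I)) m
  -- Pairing the two scores between `m` and each `w` preserves measure, so these pairs are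
  -- independent and uniform on the square.
  have h3 := (volume_measurePreserving_arrowProdEquivProdArrow I I (Fin n)).symm
  have h4 := h3.comp (h1.prod h2)
  let A : Fin n → Set (I × I) := fun w => if w ∈ W then Qᶜ else Set.univ
  have hA : ∀ w, MeasurableSet (A w) := fun w => by
    by_cases hw : w ∈ W <;> simp [A, hw, hQm.compl]
  have h5 := h4.measure_preimage (MeasurableSet.univ_pi hA).nullMeasurableSet
  rw [volume_pi_pi] at h5
  have h6 : ∏ w, volume (A w) = ENNReal.ofReal (1 - p * q) ^ W.card := by
    have : ∀ w, volume (A w) = if w ∈ W then ENNReal.ofReal (1 - p * q) else 1 := fun w => by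
      by_cases hw : w ∈ W <;> simp [A, hw, hQv]
    simp [this, Finset.prod_ite_mem]
  rw [← h6, ← h5]
  refine congrArg _ (Set.ext fun s => ?_)
  simp only [Set.mem_ofPred_eq, Set.mem_preimage, Set.mem_pi, Set.mem_univ, true_implies]
  refine forall_congr' fun w => ?_
  by_cases hw : w ∈ W
  · simp only [A, hw, if_true, true_implies]; rfl
  · simp [A, hw]

/-- If the ratings are well spread, a matching with small losses forces mutually high scores
between the best man and one of the best women. -/
lemma exists_high_scores {n : ℕ} (hn : 0 < n) {L : ℝ} (hL0 : 0 < L) (hL1 : L ≤ 1 / 16)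
    (ω : Market n) (hle : numTop ω.womanRating (3 * L) ≤ numTop ω.manRating (5 * L))
    (hpos : 0 < numTop ω.womanRating L)
    {μ : Man n ≃ Woman n} (hμ : LossAtMost (1 / 2) ω L (3 / 2 * L) μ) :
    ∃ w, 1 - 3 * L ≤ ω.womanRating w ∧
      1 - 2 * L ≤ ω.manScore (byRank ω.manRating ⟨0, hn⟩) w ∧
      1 - 7 * L ≤ ω.womanScore w (byRank ω.manRating ⟨0, hn⟩) := by
  set m := byRank ω.manRating ⟨0, hn⟩ with hm
  have halign : ω.alignedWoman m = byRank ω.womanRating ⟨0, hn⟩ := by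
    simp [alignedWoman, hm]
  have hw1 : 1 - L ≤ ω.womanRating (byRank ω.womanRating ⟨0, hn⟩) :=
    (le_byRank_iff _ _ _).2 hpos
  have hmax := le_byRank_zero hn ω.womanRating (μ m)
  have hs : ω.manScore m (μ m) ≤ 1 := (ω.2.2.1 m (μ m)).2.2
  have hr : ω.manRating m ≤ 1 := (ω.1 m).2.2
  have hpos3 : 0 < numTop ω.womanRating (3 * L) := by
    rw [← le_byRank_iff ω.womanRating (3 * L) ⟨0, hn⟩]; linarith
  have hmr : 1 - 5 * L ≤ ω.manRating m := (le_byRank_iff _ _ _).2 (hpos3.trans_le hle)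
  have hman := hμ.1 m (by linarith)
  simp only [manLoss, manUtility, linearUtility, halign] at hman
  -- The loss bound gives `r_w + s_m(w) ≥ r_top + 1 - 2L`, where `r_top ≥ 1 - L` is the best woman's
  -- rating. Here `s_m(w) ≤ 1` is used; the score bound at the end uses `r_w ≤ r_top`.
  have hw : 1 - 3 * L ≤ ω.womanRating (μ m) := by linarith
  have hwoman := hμ.2 (μ m) (by linarith)
  simp only [womanLoss, womanUtility, linearUtility, Equiv.symm_apply_apply] at hwoman
  have hal : 1 - 5 * L ≤ ω.manRating (ω.alignedMan (μ m)) := by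
    rw [alignedMan, le_byRank_iff]
    refine lt_of_lt_of_le ?_ hle
    rw [← le_byRank_iff, Equiv.apply_symm_apply]
    exact hw
  exact ⟨μ m, hw, by linarith, by linarith⟩

/-! ### Numerical estimates and conclusion -/

lemma rpow_le_pow_card {n : ℕ} (hn : 1 ≤ n) {L : ℝ} (hL0 : 0 < L) (hL1 : L ≤ 1 / 16)
    (hLn : 512 * (L ^ 3 * n) = Real.log n) {k : ℕ} (hk : k ≤ 4 * (L * n)) :
    (n : ℝ) ^ (-(1 / 8) : ℝ) ≤ (1 - 2 * L * (7 * L)) ^ k := by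
  have hn0 : (0 : ℝ) < n := by exact_mod_cast hn
  have hx : 7 / 8 ≤ 1 - 2 * L * (7 * L) := by nlinarith
  have hx0 : 0 < 1 - 2 * L * (7 * L) := by linarith
  have hlog : -(16 * L ^ 2) ≤ Real.log (1 - 2 * L * (7 * L)) := by
    refine le_trans ?_ (Real.one_sub_inv_le_log_of_pos hx0)
    -- Raising 14 to 16 absorbs the inverse, since `16 · 7/8 = 14`; then `16 · 4 = 64 = 512/8`
    -- produces the exponent `1/8`.
    have : (1 - 2 * L * (7 * L))⁻¹ ≤ 1 + 16 * L ^ 2 := by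
      rw [inv_le_iff_one_le_mul₀ hx0]
      nlinarith [sq_nonneg L, mul_nonneg (sq_nonneg L) (sub_nonneg.2 hx)]
    linarith
  rw [← Real.rpow_natCast, Real.rpow_def_of_pos hn0, Real.rpow_def_of_pos hx0, ← hLn]
  refine Real.exp_le_exp.2 ?_
  have hk' := mul_le_mul_of_nonneg_right hk (show 0 ≤ 16 * L ^ 2 by positivity)
  have := mul_le_mul_of_nonneg_right hlog (Nat.cast_nonneg (α := ℝ) k)
  nlinarith

lemma loss_bounds {n : ℕ} (hn : 32000 ≤ n) {L : ℝ}
    (hL : L = (1 / 8 : ℝ) * (Real.log (n : ℝ) / (n : ℝ)) ^ (1 / 3 : ℝ)) :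
    0 < L ∧ L ≤ 1 / 16 ∧ 10 ≤ L * n ∧ 512 * (L ^ 3 * n) = Real.log n := by
  have hn' : (32000 : ℝ) ≤ n := by exact_mod_cast hn
  have hn0 : (0 : ℝ) < n := by linarith
  have hlog1 : 1 ≤ Real.log n := by
    rw [Real.le_log_iff_exp_le hn0]
    linarith [Real.exp_one_lt_d9]
  have hlog8 : Real.log n ≤ n / 8 := by
    have h1 := Real.log_le_sub_one_of_pos (show (0 : ℝ) < n / 16 by positivity)
    have h2 := Real.log_le_sub_one_of_pos (show (0 : ℝ) < 16 by norm_num)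
    rw [Real.log_div hn0.ne' (by norm_num)] at h1
    linarith
  have hq : 0 < Real.log n / n := by positivity
  have hL0 : 0 < L := by rw [hL]; positivity
  have hcube : 512 * L ^ 3 = Real.log n / n := by
    rw [hL, mul_pow, ← Real.rpow_natCast (_ ^ (1 / 3 : ℝ)), ← Real.rpow_mul hq.le]
    norm_num
    ring
  have hmain : 512 * (L ^ 3 * n) = Real.log n := by
    rw [← mul_assoc, hcube]; field_simp
  refine ⟨hL0, ?_, ?_, hmain⟩
  · refine le_of_pow_le_pow_left₀ (n := 3) (by norm_num) (by norm_num) ?_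
    have : Real.log n / n ≤ 1 / 8 := by rw [div_le_iff₀ hn0]; linarith
    norm_num
    linarith
  · refine le_of_pow_le_pow_left₀ (n := 3) (by norm_num) (by positivity) ?_
    have h : (L * n) ^ 3 = Real.log n / 512 * n ^ 2 := by rw [← hmain]; ring
    rw [h]
    nlinarith

theorem le_volume_not_exists_lossAtMost (n : ℕ) (hn : 32000 ≤ n) (L : ℝ)
    (hL : L = (1 / 8 : ℝ) * (Real.log (n : ℝ) / (n : ℝ)) ^ (1 / 3 : ℝ)) :
    ENNReal.ofReal ((1 / 4 : ℝ) * (n : ℝ) ^ (-(1 / 8) : ℝ)) ≤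
      (volume : Measure (Market n))
        {ω | ¬ ∃ μ : Man n ≃ Woman n, LossAtMost (1 / 2) ω L (3 / 2 * L) μ} := by
  obtain ⟨hL0, hL1, hLn, hlog⟩ := loss_bounds hn hL
  have hn0 : 0 < n := by omega
  have hquarter : ENNReal.ofReal ((1 / 4 : ℝ) * (n : ℝ) ^ (-(1 / 8) : ℝ)) =
      ENNReal.ofReal (1 / 2) * (ENNReal.ofReal (1 / 2) *
        ENNReal.ofReal ((n : ℝ) ^ (-(1 / 8) : ℝ))) := by
    rw [← ENNReal.ofReal_mul (by norm_num), ← ENNReal.ofReal_mul (by norm_num)]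
    congr 1; ring
  rw [hquarter]
  -- Condition on the men's ratings, then on the women's; only the scores remain random.
  refine mul_le_prod_of_le_section (half_le_volume_men hL0 hL1 hLn) fun rm hrm => ?_
  refine mul_le_prod_of_le_section (half_le_volume_women hL0 hL1 hLn) fun rv hrw => ?_
  simp only [Set.mem_ofPred_eq] at hrm hrw
  let W : Finset (Fin n) := Finset.univ.filter fun w => 1 - 3 * L ≤ (rv w : ℝ)
  have hW : (W.card : ℝ) ≤ 4 * (L * n) := hrw.1
  calc ENNReal.ofReal ((n : ℝ) ^ (-(1 / 8) : ℝ))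
      ≤ ENNReal.ofReal ((1 - 2 * L * (7 * L)) ^ W.card) :=
        ENNReal.ofReal_le_ofReal (rpow_le_pow_card hn0 hL0 hL1 hlog hW)
    _ = ENNReal.ofReal (1 - 2 * L * (7 * L)) ^ W.card := ENNReal.ofReal_pow (by nlinarith) _
    _ = _ := (volume_scores_eq (byRank (fun i => (rm i : ℝ)) ⟨0, hn0⟩) W (p := 2 * L)
        (q := 7 * L) (by linarith) (by linarith) (by linarith) (by linarith)).symm
    _ ≤ _ := measure_mono fun s hs => ?_
  rintro ⟨μ, hμ⟩
  obtain ⟨w, hw, h1, h2⟩ := exists_high_scores hn0 hL0 hL1 (rm, rv, s)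
    (by exact_mod_cast hrw.1.trans hrm) hrw.2 hμ
  exact hs w (Finset.mem_filter.2 ⟨Finset.mem_univ w, hw⟩) ⟨h1, h2⟩

end Market

theorem mainTheorem9 (n : ℕ) (hn : 32000 ≤ n) (L : ℝ)
    (hL : L = (1 / 8 : ℝ) * (Real.log (n : ℝ) / (n : ℝ)) ^ (1 / 3 : ℝ)) :
    ENNReal.ofReal ((1 / 4 : ℝ) * (n : ℝ) ^ (-(1 / 8) : ℝ)) ≤
        (volume : Measure (Market n))
          {ω | ¬ ∃ μ : Man n ≃ Woman n, Market.LossAtMost (1 / 2) ω L (3 / 2 * L) μ} ∧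
      ENNReal.ofReal ((1 / 4 : ℝ) * (n : ℝ) ^ (-(1 / 8) : ℝ)) ≤
        (volume : Measure (Market n))
          {ω | ¬ ∃ μ : Man n ≃ Woman n,
            Market.IsStable (1 / 2) ω μ ∧ Market.LossAtMost (1 / 2) ω L (3 / 2 * L) μ} := by
  have h := Market.le_volume_not_exists_lossAtMost n hn L hL
  exact ⟨h, h.trans (measure_mono fun ω hω ⟨μ, _, hμ⟩ => hω ⟨μ, hμ⟩)⟩
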